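/- **Theorem 2.6.** Let $a$ be a nonzero real number and let $m_1,m_2,m_3\in\mathbb N=\{0,1,2,\dots\}$. For $0\ne b\in\mathbb C$ and $i\in\mathbb N$ put $\xi_{b,0}(t)=1$, $\xi_{b,1}(t)=t/b$ and, for $i\ge 2$, $$\xi_{b,i}(t)=\frac{t^i}{i!\,b^i}-\frac{t^{i-1}}{(i-2)!\,b^{i+1}}+\sum_{r=2}^{i-1}\frac{(-1)^r\prod_{s=1}^{r-1}(i+s)}{(i-r-1)!\,r!\,b^{r+i}}\,t^{i-r}.$$ For real $t$ let $\zeta_{i,0}(t)$ and $\zeta_{i,1}(t)$ be the real and imaginary parts of $\xi_{2a\sqrt{-1},i}(t)$, so that $\xi_{2a\sqrt{-1},i}=\zeta_{i,0}+\zeta_{i,1}\sqrt{-1}$. For $\alpha=(\alpha_1,\dots,\alpha_{11})\in\mathbb N^{11}$ put $\alpha!=\prod_{i=1}^{11}\alpha_i!$, $$|\alpha|_1=\sum_{i=1}^{7}i\alpha_i+\alpha_8+2\alpha_9+3\alpha_{10}+\alpha_{11},$$ and define the differential operator $d_\alpha$ on $\mathbb R[x,y,z]$ by $$\begin{aligne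d}d_\alpha={}&\frac{|\alpha|_1!}{\alpha!}\,2^{-\alpha_4}\,3^{-\alpha_3-\alpha_4-\alpha_5-2\alpha_6-2\alpha_7-\alpha_{10}}\,7^{-\alpha_7}\;x^{\alpha_8+\alpha_9+\alpha_{10}}\,y^{\alpha_{11}}\\&\times\partial_x^{2\alpha_1+\alpha_2}\,\partial_y^{2(\alpha_2+\alpha_5+\alpha_8)+\alpha_6+\alpha_9}\,\partial_z^{2(2\alpha_5+3\alpha_6+4\alpha_7+\alpha_9+2\alpha_{10}+\alpha_{11})}\\&\times(\partial_y^4+2\partial_x\partial_y\partial_z^2)^{\alpha_3}\,(3\partial_y^3\partial_z^2+\partial_x\partial_z^4)^{\alpha_4}.\end{aligned}$$ Then $d_\alpha(x^{m_1}y^{m_2}z^{m_3})\ne 0$ for only finitely many $\alpha\in\mathbb N^{11}$, so that $$P=\sum_{\alpha\in\mathbb N^{11}}\zeta_{|\alpha|_1,0}(t)\,d_\alpha(x^{m_1}y^{m_2}z^{m_3}),\qquad Q=\sum_{\alpha\in\mathbb N^{11}}\zeta_{|\alpha|_1,1}(t)\,d_\alpha(x^{m_1}y^{m_2}z^{m_3})$$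 are finite sums; they are real polynomials in $t,x,y,z$, and the two functions $$u=\cos(at)\,P-\sin(at)\,Q,\qquad u=\sin(at)\,P+\cos(at)\,Q$$ are smooth real solutions on all of $\mathbb R^4$ of the generalized Klein–Gordon equation $$u_{tt}-u_{xx}-x\,u_{yy}-y\,u_{zz}+a^2u=0.$$ -/

import Mathlib

open scoped Nat ContDiff
open MvPolynomial

namespace KleinGordon

/-- The polynomial function `ξ_{b,i}(t)`
`= t^i/(i! b^i) - t^(i-1)/((i-2)! b^(i+1))`
`+ ∑_{r=2}^{i-1} (-1)^r (i+1)⋯(i+r-1) / ((i-r-1)! r! b^(r+i)) t^(i-r)`.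
The middle term is the summand `r = 1`.  For `i = 0` and `i = 1` the sum is empty, which gives
`ξ_{b,0} = 1` and `ξ_{b,1} = t/b`. -/
noncomputable def xi (b : ℂ) (i : ℕ) (t : ℂ) : ℂ :=
  t ^ i / ((i ! : ℂ) * b ^ i) +
    ∑ r ∈ Finset.Icc 1 (i - 1),
      (-1) ^ r * (∏ s ∈ Finset.Icc 1 (r - 1), ((i : ℂ) + (s : ℂ))) /
        (((i - r - 1)! : ℂ) * (r ! : ℂ) * b ^ (r + i)) * t ^ (i - r)

/-- `ζ_{i,0}(t)`, the real part of `ξ_{2a√-1,i}(t)` for real `t`. -/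
noncomputable def zeta0 (a : ℝ) (i : ℕ) (t : ℝ) : ℝ :=
  (xi (2 * (a : ℂ) * Complex.I) i (t : ℂ)).re

/-- `ζ_{i,1}(t)`, the imaginary part of `ξ_{2a√-1,i}(t)` for real `t`. -/
noncomputable def zeta1 (a : ℝ) (i : ℕ) (t : ℝ) : ℝ :=
  (xi (2 * (a : ℂ) * Complex.I) i (t : ℂ)).im

/-- `|α|₁`; the entry `α_j` of the multi-index is `α (j - 1)`. -/
def weight (α : Fin 11 → ℕ) : ℕ :=
  α 0 + 2 * α 1 + 3 * α 2 + 4 * α 3 + 5 * α 4 + 6 * α 5 + 7 * α 6 +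
    α 7 + 2 * α 8 + 3 * α 9 + α 10

/-- Real polynomials in `x = X 0`, `y = X 1`, `z = X 2`. -/
abbrev Poly3 : Type := MvPolynomial (Fin 3) ℝ

/-- The partial derivative `∂_x`, `∂_y`, `∂_z` for `j = 0, 1, 2`, as a linear operator on
polynomials; products and powers of operators are compositions. -/
noncomputable def D (j : Fin 3) : Module.End ℝ Poly3 :=
  (pderiv j : Derivation ℝ Poly3 Poly3).toLinearMap

/-- The coefficient
`(|α|₁! / α!) 2^(-α₄) 3^(-α₃-α₄-α₅-2α₆-2α₇-α₁₀) 7^(-α₇)` of `d_α`. -/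
noncomputable def dCoeff (α : Fin 11 → ℕ) : ℝ :=
  ((weight α)! : ℝ) / (∏ j, ((α j)! : ℝ)) /
    (2 ^ α 3 * 3 ^ (α 2 + α 3 + α 4 + 2 * α 5 + 2 * α 6 + α 9) * 7 ^ α 6)

/-- The operator `d_α`:  `dCoeff α` times
`x^(α₈+α₉+α₁₀) y^(α₁₁) ∂_x^(2α₁+α₂) ∂_y^(2(α₂+α₅+α₈)+α₆+α₉)`
`∂_z^(2(2α₅+3α₆+4α₇+α₉+2α₁₀+α₁₁))`
`(∂_y⁴ + 2∂_x∂_y∂_z²)^(α₃) (3∂_y³∂_z² + ∂_x∂_z⁴)^(α₄)`. -/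
noncomputable def dOp (α : Fin 11 → ℕ) : Module.End ℝ Poly3 :=
  dCoeff α •
    (LinearMap.mulLeft ℝ ((X 0 : Poly3) ^ (α 7 + α 8 + α 9) * (X 1 : Poly3) ^ α 10) *
      D 0 ^ (2 * α 0 + α 1) *
      D 1 ^ (2 * (α 1 + α 4 + α 7) + α 5 + α 8) *
      D 2 ^ (2 * (2 * α 4 + 3 * α 5 + 4 * α 6 + α 8 + 2 * α 9 + α 10)) *
      (D 1 ^ 4 + (2 : ℝ) • (D 0 * D 1 * D 2 ^ 2)) ^ α 2 *
      ((3 : ℝ) • (D 1 ^ 3 * D 2 ^ 2) + D 0 * D 2 ^ 4) ^ α 3)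

/-- The polynomial `d_α(x^m₁ y^m₂ z^m₃)`. -/
noncomputable def dMon (m₁ m₂ m₃ : ℕ) (α : Fin 11 → ℕ) : Poly3 :=
  dOp α ((X 0 : Poly3) ^ m₁ * (X 1 : Poly3) ^ m₂ * (X 2 : Poly3) ^ m₃)

/-- `P = ∑_α ζ_{|α|₁,0}(t) d_α(x^m₁ y^m₂ z^m₃)`. -/
noncomputable def P (a : ℝ) (m₁ m₂ m₃ : ℕ) (t x y z : ℝ) : ℝ :=
  ∑ᶠ α : Fin 11 → ℕ, zeta0 a (weight α) t * eval ![x, y, z] (dMon m₁ m₂ m₃ α)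

/-- `Q = ∑_α ζ_{|α|₁,1}(t) d_α(x^m₁ y^m₂ z^m₃)`. -/
noncomputable def Q (a : ℝ) (m₁ m₂ m₃ : ℕ) (t x y z : ℝ) : ℝ :=
  ∑ᶠ α : Fin 11 → ℕ, zeta1 a (weight α) t * eval ![x, y, z] (dMon m₁ m₂ m₃ α)

/-- `u` is a smooth solution on all of `ℝ⁴` of
`u_tt - u_xx - x u_yy - y u_zz + a² u = 0`. -/
def IsSolution (a : ℝ) (u : ℝ → ℝ → ℝ → ℝ → ℝ) : Prop :=
  ContDiff ℝ ∞ (fun p : ℝ × ℝ × ℝ × ℝ => u p.1 p.2.1 p.2.2.1 p.2.2.2) ∧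
  ∀ t x y z : ℝ,
    iteratedDeriv 2 (fun s => u s x y z) t - iteratedDeriv 2 (fun s => u t s y z) x -
      x * iteratedDeriv 2 (fun s => u t x s z) y -
      y * iteratedDeriv 2 (fun s => u t x y s) z + a ^ 2 * u t x y z = 0

end KleinGordon

/-
Let `T = ∂_x² + x ∂_y² + y ∂_z²`, which is locally nilpotent on polynomials, and `b = 2ai`. Since
`ξ_{b,k+1}'' + b ξ_{b,k+1}' = ξ_{b,k}` and `ξ_{b,0} = 1`, the functions `c_k = e^{iat} ξ_{b,k}`
satisfy `c_{k+1}'' + a² c_{k+1} = c_k` and `c_0'' + a² c_0 = 0`, so `∑_k c_k(t) T^k f` solves the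
equation for every polynomial `f`, and so do its real and imaginary parts. These are the two
functions `u`, because `T^k = ∑_{|α|₁ = k} d_α`: the normal-ordered symbol of `exp (s T)` is the
exponential of a polynomial `∑_j s^{w_j} τ_j` with eleven terms, one for each entry of `α`.
-/

namespace KleinGordon

section ExponentialPart

variable {ι : Type*} [Fintype ι] [DecidableEq ι]

/-- The exponents `α` of weighted degree `∑ w_j α_j = k`, for positive weights `w`. The degree is
an integer so that shifting it down by a weight needs no side condition. -/
def level (w : ι → ℕ) (k : ℤ) : Finset (ι → ℕ) :=
  {α ∈ Fintype.piFinset fun _ => Finset.range (k.toNat + 1) | ((∑ j, w j * α j : ℕ) : ℤ) = k}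

theorem mem_level {w : ι → ℕ} (hw : ∀ j, 0 < w j) {k : ℤ} {α : ι → ℕ} :
    α ∈ level w k ↔ ((∑ j, w j * α j : ℕ) : ℤ) = k := by
  refine ⟨fun h => (Finset.mem_filter.1 h).2, fun h => Finset.mem_filter.2 ⟨?_, h⟩⟩
  refine Fintype.mem_piFinset.2 fun j => Finset.mem_range.2 ?_
  have h₁ : α j ≤ w j * α j := Nat.le_mul_of_pos_left _ (hw j)
  have h₂ : w j * α j ≤ ∑ i, w i * α i :=
    Finset.single_le_sum (f := fun i => w i * α i) (fun _ _ => Nat.zero_le _) (Finset.mem_univ j)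
  lia

variable {K : Type*} [Field K]

/-- The coefficient of `s ^ k` in `exp (∑ j, s ^ w j * X j)`, for positive weights `w`. -/
noncomputable def expPart (w : ι → ℕ) (k : ℤ) : MvPolynomial ι K :=
  ∑ α ∈ level w k, monomial (Finsupp.equivFunOnFinite.symm α) (∏ j, ((α j)! : K))⁻¹

variable {w : ι → ℕ}

theorem coeff_expPart (hw : ∀ j, 0 < w j) (k : ℤ) (α : ι →₀ ℕ) :
    coeff α (expPart w k : MvPolynomial ι K) =
      if ((∑ j, w j * α j : ℕ) : ℤ) = k then (∏ j, ((α j)! : K))⁻¹ else 0 := by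
  simp only [expPart, coeff_sum, coeff_monomial, Equiv.symm_apply_eq, Finset.sum_ite_eq',
    mem_level hw, Finsupp.equivFunOnFinite_apply]

theorem expPart_zero (hw : ∀ j, 0 < w j) : (expPart w 0 : MvPolynomial ι K) = 1 := by
  ext α
  have h : ((∑ j, w j * α j : ℕ) : ℤ) = 0 ↔ 0 = α := by
    rw [Nat.cast_eq_zero, Finset.sum_eq_zero_iff]
    simp [DFunLike.ext_iff, (hw _).ne', eq_comm]
  rw [coeff_expPart hw, coeff_one]
  simp only [h]
  split_ifs with hα
  · simp [← hα]
  · rfl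

theorem pderiv_expPart [CharZero K] (hw : ∀ j, 0 < w j) (j : ι) (k : ℤ) :
    pderiv j (expPart w k : MvPolynomial ι K) = expPart w (k - w j) := by
  ext α
  have hdeg : ∑ i, w i * (α + Finsupp.single j 1 : ι →₀ ℕ) i = (∑ i, w i * α i) + w j := by
    simp [mul_add, Finset.sum_add_distrib, Finsupp.single_apply]
  have hfac : ∏ i, (((α + Finsupp.single j 1 : ι →₀ ℕ) i)! : K) =
      (∏ i, ((α i)! : K)) * (α j + 1) := by
    rw [← Finset.mul_prod_erase _ _ (Finset.mem_univ j),
      ← Finset.mul_prod_erase _ _ (Finset.mem_univ j),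
      Finset.prod_congr rfl fun i hi => by
        rw [Finsupp.add_apply, Finsupp.single_eq_of_ne (Finset.ne_of_mem_erase hi), add_zero]]
    simp only [Finsupp.add_apply, Finsupp.single_eq_same, Nat.factorial_succ]
    push_cast
    ring
  have hne : (α j + 1 : K) ≠ 0 := Nat.cast_add_one_ne_zero _
  simp only [coeff_pderiv, coeff_expPart hw, hdeg, hfac, eq_sub_iff_add_eq, Nat.cast_add,
    ite_mul, zero_mul, mul_inv, inv_mul_cancel_right₀ hne]

theorem isWeightedHomogeneous_expPart (hw : ∀ j, 0 < w j) (k : ℕ) :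
    (expPart w k : MvPolynomial ι K).IsWeightedHomogeneous w k := by
  intro α hα
  rw [coeff_expPart hw] at hα
  have h := (ite_ne_right_iff.1 hα).1
  rw [Finsupp.weight_apply, Finsupp.sum_fintype _ _ (by simp)]
  simpa [mul_comm] using Nat.cast_inj.1 h

theorem smul_expPart [CharZero K] (hw : ∀ j, 0 < w j) (k : ℕ) :
    (k : K) • (expPart w k : MvPolynomial ι K) =
      ∑ j, (w j : K) • (X j * expPart w (k - w j)) := by
  simp only [Nat.cast_smul_eq_nsmul, ← (isWeightedHomogeneous_expPart hw k).sum_weight_X_mul_pderiv,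
    pderiv_expPart hw]

end ExponentialPart

theorem derivation_aeval {ι R A M : Type*} [Fintype ι] [CommSemiring R] [CommSemiring A]
    [Algebra R A] [AddCommMonoid M] [Module A M] [Module R M] [IsScalarTower R A M]
    (d : Derivation R A M) (τ : ι → A) (p : MvPolynomial ι R) :
    d (aeval τ p) = ∑ j, aeval τ (pderiv j p) • d (τ j) := by
  classical
  induction p using MvPolynomial.induction_on with
  | C r => simp
  | add p q hp hq => simp only [map_add, hp, hq, add_smul, Finset.sum_add_distrib]
  | mul_X p i hp =>
    simp [Derivation.leibniz, hp, pderiv_X, Pi.single_apply, apply_ite, ite_smul, add_smul,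
      Finset.sum_add_distrib, Finset.smul_sum, smul_smul]

section DifferentialOperators

open scoped TensorProduct

variable {R : Type*} [CommSemiring R] {ι : Type*}

theorem pderiv_comm (i j : ι) (f : MvPolynomial ι R) :
    pderiv i (pderiv j f) = pderiv j (pderiv i f) := by
  obtain rfl | hij := eq_or_ne i j
  · rfl
  · ext m
    simp only [coeff_pderiv, Finsupp.add_apply, Finsupp.single_eq_of_ne hij,
      Finsupp.single_eq_of_ne hij.symm, add_zero, add_right_comm m, mul_right_comm]

open scoped IsMulCommutative in
/-- The constant-coefficient differential operator obtained from a polynomial by substituting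
`∂_i` for `X i`. -/
noncomputable def diffOp : MvPolynomial ι R →ₐ[R] Module.End R (MvPolynomial ι R) :=
  let s : Set (Module.End R (MvPolynomial ι R)) := Set.range fun i => (pderiv i).toLinearMap
  have : IsMulCommutative (Algebra.adjoin R s) := Algebra.isMulCommutative_adjoin R <| by
    rintro _ ⟨i, rfl⟩ _ ⟨j, rfl⟩
    exact LinearMap.ext (pderiv_comm i j)
  (Algebra.adjoin R s).val.comp <|
    aeval fun i => ⟨(pderiv i).toLinearMap, Algebra.subset_adjoin ⟨i, rfl⟩⟩

theorem diffOp_X (i : ι) : diffOp (X i : MvPolynomial ι R) = (pderiv i).toLinearMap := by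
  simp [diffOp]

theorem diffOp_eq_zero {k : ℕ} {q f : MvPolynomial ι R} (hq : q ∈ idealOfVars ι R ^ k)
    (hf : ∀ m : ι →₀ ℕ, k ≤ m.degree → coeff m f = 0) : diffOp q f = 0 := by
  induction k generalizing q f with
  | zero =>
    have hf₀ : f = 0 := MvPolynomial.ext _ _ fun m => hf m (Nat.zero_le _)
    rw [hf₀, map_zero]
  | succ k ih =>
    rw [pow_succ'] at hq
    refine Submodule.mul_induction_on hq (fun p hp q hq => ?_) fun p q hp hq => ?_
    · induction hp using Submodule.span_induction with
      | mem _ hx =>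
        obtain ⟨i, rfl⟩ := hx
        rw [mul_comm, map_mul, diffOp_X]
        refine ih hq fun m hm => ?_
        rw [Derivation.coeFn_coe, coeff_pderiv, hf _ (by simpa using hm), zero_mul]
      | zero => simp
      | add p₁ p₂ _ _ h₁ h₂ => rw [add_mul, map_add, LinearMap.add_apply, h₁, h₂, add_zero]
      | smul r p _ h => rw [smul_eq_mul, mul_assoc, map_mul, Module.End.mul_apply, h, map_zero]
    · rw [map_add, LinearMap.add_apply, hp, hq, add_zero]

/-- The differential operator with polynomial coefficients whose normal-ordered symbol is a given
polynomial: `X (inl i)` stands for multiplication by the `i`-th variable, `X (inr i)` for `∂_i`,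
and multiplications are put to the left of all derivatives. -/
noncomputable def quantize : MvPolynomial (ι ⊕ ι) R →ₗ[R] Module.End R (MvPolynomial ι R) :=
  TensorProduct.lift ((LinearMap.mul R (Module.End R (MvPolynomial ι R))).compl₁₂
      (LinearMap.mul R (MvPolynomial ι R)) diffOp.toLinearMap) ∘ₗ
    (tensorEquivSum R ι ι R).symm.toLinearMap

theorem tensorEquivSum_tmul (p q : MvPolynomial ι R) :
    tensorEquivSum R ι ι R (p ⊗ₜ q) = rename Sum.inl p * rename Sum.inr q := by
  have hl : ((tensorEquivSum R ι ι R).toAlgHom.comp Algebra.TensorProduct.includeLeft) =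
      rename Sum.inl := by ext; simp
  have hr : ((tensorEquivSum R ι ι R).toAlgHom.comp Algebra.TensorProduct.includeRight) =
      rename Sum.inr := by ext; simp
  rw [← hl, ← hr]
  simp [← map_mul]

theorem quantize_rename_mul_rename (p q : MvPolynomial ι R) :
    quantize (rename Sum.inl p * rename Sum.inr q) = LinearMap.mulLeft R p * diffOp q := by
  rw [← tensorEquivSum_tmul]
  simp only [quantize, LinearMap.comp_apply, AlgEquiv.toLinearMap_apply,
    AlgEquiv.symm_apply_apply, TensorProduct.lift.tmul, LinearMap.compl₁₂_apply,
    AlgHom.toLinearMap_apply, LinearMap.mul_apply']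
  rfl

theorem symbol_induction {motive : MvPolynomial (ι ⊕ ι) R → Prop}
    (mul : ∀ p q, motive (rename Sum.inl p * rename Sum.inr q))
    (add : ∀ σ τ, motive σ → motive τ → motive (σ + τ)) (σ : MvPolynomial (ι ⊕ ι) R) :
    motive σ := by
  obtain ⟨s, rfl⟩ := (tensorEquivSum R ι ι R).surjective σ
  induction s using TensorProduct.induction_on with
  | zero => simpa using mul 0 0
  | tmul p q => rw [tensorEquivSum_tmul]; exact mul p q
  | add s t hs ht => rw [map_add]; exact add _ _ hs ht

theorem quantize_one : quantize (1 : MvPolynomial (ι ⊕ ι) R) = 1 := by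
  simpa only [map_one, mul_one, LinearMap.mulLeft_one, ← Module.End.one_eq_id] using
    quantize_rename_mul_rename (1 : MvPolynomial ι R) 1

theorem quantize_X_inl_mul (i : ι) (σ : MvPolynomial (ι ⊕ ι) R) :
    quantize (X (Sum.inl i) * σ) = LinearMap.mulLeft R (X i) * quantize σ := by
  induction σ using symbol_induction with
  | mul p q =>
    rw [← mul_assoc, ← rename_X Sum.inl, ← map_mul, quantize_rename_mul_rename,
      quantize_rename_mul_rename, LinearMap.mulLeft_mul, ← Module.End.mul_eq_comp, mul_assoc]
  | add σ τ hσ hτ => rw [mul_add, map_add, map_add, hσ, hτ, mul_add]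

theorem pderiv_inl_rename_inr (i : ι) (p : MvPolynomial ι R) :
    pderiv (Sum.inl i) (rename Sum.inr p : MvPolynomial (ι ⊕ ι) R) = 0 := by
  classical
  refine pderiv_eq_zero_of_notMem_vars fun h => ?_
  simpa using vars_rename Sum.inr p h

theorem pderiv_mul_quantize (i : ι) (σ : MvPolynomial (ι ⊕ ι) R) :
    (pderiv i).toLinearMap * quantize σ =
      quantize (pderiv (Sum.inl i) σ + X (Sum.inr i) * σ) := by
  induction σ using symbol_induction with
  | mul p q =>
    have hσ : pderiv (Sum.inl i) (rename Sum.inl p * rename Sum.inr q) +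
        X (Sum.inr i) * (rename Sum.inl p * rename Sum.inr q) =
          rename Sum.inl (pderiv i p) * rename Sum.inr q +
          rename Sum.inl p * rename Sum.inr (X i * q) := by
      rw [Derivation.leibniz, pderiv_inl_rename_inr, pderiv_rename Sum.inl_injective, map_mul,
        rename_X, smul_zero, zero_add, smul_eq_mul]
      ring
    rw [hσ, map_add, quantize_rename_mul_rename, quantize_rename_mul_rename,
      quantize_rename_mul_rename, map_mul, diffOp_X]
    refine LinearMap.ext fun f => ?_
    simp only [Module.End.mul_apply, LinearMap.mulLeft_apply, Derivation.coeFn_coe,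
      Derivation.leibniz, smul_eq_mul, LinearMap.add_apply]
    ring
  | add σ τ hσ hτ => rw [map_add, mul_add, hσ, hτ, ← map_add, map_add (pderiv _), mul_add,
      add_add_add_comm]

end DifferentialOperators

section FlagLaplacian

/-- The operator `∂_x² + x ∂_y² + y ∂_z²`. -/
noncomputable def flagLaplacian : Module.End ℝ Poly3 :=
  D 0 ^ 2 + LinearMap.mulLeft ℝ (X 0) * D 1 ^ 2 + LinearMap.mulLeft ℝ (X 1) * D 2 ^ 2

/-- The weights with which `α` enters `|α|₁`. -/
def wt : Fin 11 → ℕ := ![1, 2, 3, 4, 5, 6, 7, 1, 2, 3, 1]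

/-- The coefficient polynomials of the eleven operators whose normal-ordered products are,
up to scalars, the `d_α`. -/
noncomputable def coeffPart : Fin 11 → Poly3 :=
  ![1, 1, 1, 1, 1, 1, 1, X 0, X 0, X 0, X 1]

/-- The constant-coefficient parts of the eleven operators whose normal-ordered products are,
up to scalars, the `d_α`; here `X j` stands for `∂_x`, `∂_y`, `∂_z`. -/
noncomputable def diffPart : Fin 11 → Poly3 :=
  ![X 0 ^ 2, X 0 * X 1 ^ 2, (1 / 3 : ℝ) • (X 1 ^ 4 + (2 : ℝ) • (X 0 * X 1 * X 2 ^ 2)),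
    (1 / 6 : ℝ) • ((3 : ℝ) • (X 1 ^ 3 * X 2 ^ 2) + X 0 * X 2 ^ 4),
    (1 / 3 : ℝ) • (X 1 ^ 2 * X 2 ^ 4), (1 / 9 : ℝ) • (X 1 * X 2 ^ 6), (1 / 63 : ℝ) • X 2 ^ 8,
    X 1 ^ 2, X 1 * X 2 ^ 2, (1 / 3 : ℝ) • X 2 ^ 4, X 2 ^ 2]

/-- The symbols of the eleven operators whose normal-ordered products are, up to scalars,
the `d_α`. -/
noncomputable def tau (j : Fin 11) : MvPolynomial (Fin 3 ⊕ Fin 3) ℝ :=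
  rename Sum.inl (coeffPart j) * rename Sum.inr (diffPart j)

/-- The coefficient of `s ^ k` in the normal-ordered symbol `exp (∑ j, s ^ wt j * tau j)` of
`exp (s * flagLaplacian)`. -/
noncomputable def heatSymbol (k : ℤ) : MvPolynomial (Fin 3 ⊕ Fin 3) ℝ :=
  aeval tau (expPart wt k : MvPolynomial (Fin 11) ℝ)

@[to_additive]
theorem prod_univ_eleven {M : Type*} [CommMonoid M] (f : Fin 11 → M) :
    ∏ j, f j = f 0 * f 1 * f 2 * f 3 * f 4 * f 5 * f 6 * f 7 * f 8 * f 9 * f 10 := by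
  rw [Fin.prod_univ_castSucc, Fin.prod_univ_castSucc, Fin.prod_univ_castSucc,
    Fin.prod_univ_eight]
  rfl

theorem wt_pos : ∀ j, 0 < wt j := by decide

theorem weight_eq_sum (α : Fin 11 → ℕ) : weight α = ∑ j, wt j * α j := by
  rw [sum_univ_eleven]
  simp [weight, wt]

theorem mem_level_wt {k : ℕ} {α : Fin 11 → ℕ} : α ∈ level wt k ↔ weight α = k := by
  rw [mem_level wt_pos, weight_eq_sum, Nat.cast_inj]

theorem prod_coeffPart_pow (α : Fin 11 → ℕ) :
    ∏ j, coeffPart j ^ α j = X 0 ^ (α 7 + α 8 + α 9) * X 1 ^ α 10 := by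
  rw [prod_univ_eleven]
  simp [coeffPart, pow_add]

theorem prod_diffPart_pow (α : Fin 11 → ℕ) :
    ∏ j, diffPart j ^ α j =
      (2 ^ α 3 * 3 ^ (α 2 + α 3 + α 4 + 2 * α 5 + 2 * α 6 + α 9) * 7 ^ α 6 : ℝ)⁻¹ •
      (X 0 ^ (2 * α 0 + α 1) * X 1 ^ (2 * (α 1 + α 4 + α 7) + α 5 + α 8) *
        X 2 ^ (2 * (2 * α 4 + 3 * α 5 + 4 * α 6 + α 8 + 2 * α 9 + α 10)) *
        (X 1 ^ 4 + (2 : ℝ) • (X 0 * X 1 * X 2 ^ 2)) ^ α 2 *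
        ((3 : ℝ) • (X 1 ^ 3 * X 2 ^ 2) + X 0 * X 2 ^ 4) ^ α 3) := by
  have hc : (2 ^ α 3 * 3 ^ (α 2 + α 3 + α 4 + 2 * α 5 + 2 * α 6 + α 9) * 7 ^ α 6 : ℝ)⁻¹ =
      (1 / 3) ^ α 2 * (1 / 6) ^ α 3 * (1 / 3) ^ α 4 * (1 / 9) ^ α 5 * (1 / 63) ^ α 6 *
        (1 / 3) ^ α 9 := by
    rw [show (6 : ℝ) = 2 * 3 by norm_num, show (9 : ℝ) = 3 ^ 2 by norm_num,
      show (63 : ℝ) = 3 ^ 2 * 7 by norm_num]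
    simp only [one_div, inv_pow, mul_pow, ← pow_mul, pow_add, mul_inv]
    ring
  rw [hc, prod_univ_eleven]
  simp only [diffPart, Fin.isValue, Matrix.cons_val]
  generalize (X 1 ^ 4 + (2 : ℝ) • (X 0 * X 1 * X 2 ^ 2) : Poly3) = U
  generalize ((3 : ℝ) • (X 1 ^ 3 * X 2 ^ 2) + X 0 * X 2 ^ 4 : Poly3) = V
  simp only [smul_pow, smul_mul_assoc, mul_smul_comm, smul_smul]
  exact congrArg₂ (· • ·) (by ring) (by ring)

theorem dOp_eq (α : Fin 11 → ℕ) :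
    dOp α = ((weight α)! / ∏ j, ((α j)! : ℝ)) •
      (LinearMap.mulLeft ℝ (∏ j, coeffPart j ^ α j) * diffOp (∏ j, diffPart j ^ α j)) := by
  rw [prod_coeffPart_pow, prod_diffPart_pow, dOp, dCoeff, map_smul, mul_smul_comm, smul_smul,
    div_eq_mul_inv (_ / _)]
  simp only [map_mul, map_pow, map_add, map_smul, diffOp_X, D, mul_assoc]

theorem factorial_smul_quantize_heatSymbol (k : ℕ) :
    (k ! : ℝ) • quantize (heatSymbol k) = ∑ α ∈ level wt k, dOp α := by
  simp only [heatSymbol, expPart, map_sum, Finset.smul_sum]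
  refine Finset.sum_congr rfl fun α hα => ?_
  have hsymbol : ∏ j, tau j ^ α j = rename Sum.inl (∏ j, coeffPart j ^ α j) *
      rename Sum.inr (∏ j, diffPart j ^ α j) := by
    simp only [tau, mul_pow, Finset.prod_mul_distrib, map_prod, map_pow]
  rw [aeval_monomial, Finsupp.prod_fintype _ _ fun _ => pow_zero _]
  simp only [Finsupp.equivFunOnFinite_symm_apply_apply]
  rw [hsymbol, ← Algebra.smul_def, map_smul, quantize_rename_mul_rename, dOp_eq, smul_smul,
    mem_level_wt.1 hα, div_eq_mul_inv]

theorem heatSymbol_zero : heatSymbol 0 = 1 := by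
  rw [heatSymbol, expPart_zero wt_pos, map_one]

theorem smul_heatSymbol (k : ℕ) :
    (k : ℝ) • heatSymbol k = ∑ j, (wt j : ℝ) • (tau j * heatSymbol (k - wt j)) := by
  simpa only [heatSymbol, map_smul, map_sum, map_mul, aeval_X] using
    congrArg (aeval tau) (smul_expPart (K := ℝ) wt_pos k)

theorem pderiv_heatSymbol (i : Fin 3 ⊕ Fin 3) (k : ℤ) :
    pderiv i (heatSymbol k) = ∑ j, heatSymbol (k - wt j) * pderiv i (tau j) := by
  simp only [heatSymbol, derivation_aeval, pderiv_expPart wt_pos, smul_eq_mul]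

theorem pderiv_x_heatSymbol (k : ℤ) :
    pderiv (Sum.inl 0) (heatSymbol k) =
      X (Sum.inr 1) ^ 2 * heatSymbol (k - 1) +
      X (Sum.inr 1) * X (Sum.inr 2) ^ 2 * heatSymbol (k - 2) +
      (1 / 3 : ℝ) • (X (Sum.inr 2) ^ 4 * heatSymbol (k - 3)) := by
  rw [pderiv_heatSymbol, sum_univ_eleven]
  generalize heatSymbol = G
  simp [tau, coeffPart, diffPart, wt, Derivation.leibniz, Derivation.leibniz_pow, pderiv_X,
    mul_comm]

theorem pderiv_y_heatSymbol (k : ℤ) :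
    pderiv (Sum.inl 1) (heatSymbol k) =
      X (Sum.inr 2) ^ 2 * heatSymbol (k - 1) := by
  rw [pderiv_heatSymbol, sum_univ_eleven]
  generalize heatSymbol = G
  simp [tau, coeffPart, diffPart, wt, Derivation.leibniz, Derivation.leibniz_pow, pderiv_X,
    mul_comm]

theorem pderiv_z_heatSymbol (k : ℤ) :
    pderiv (Sum.inl 2) (heatSymbol k) = 0 := by
  rw [pderiv_heatSymbol, sum_univ_eleven]
  generalize heatSymbol = G
  simp [tau, coeffPart, diffPart, wt, Derivation.leibniz, Derivation.leibniz_pow, pderiv_X]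

theorem D_sq_mul_quantize (i : Fin 3) (σ : MvPolynomial (Fin 3 ⊕ Fin 3) ℝ) :
    D i ^ 2 * quantize σ = quantize (pderiv (Sum.inl i) (pderiv (Sum.inl i) σ) +
      (2 : ℝ) • (X (Sum.inr i) * pderiv (Sum.inl i) σ) + X (Sum.inr i) ^ 2 * σ) := by
  rw [pow_two, mul_assoc, D, pderiv_mul_quantize, pderiv_mul_quantize]
  congr 1
  simp only [map_add, Derivation.leibniz, smul_eq_mul, pderiv_X_of_ne Sum.inr_ne_inl, mul_zero,
    add_zero]
  algebra

theorem flagLaplacian_mul_quantize_heatSymbol (k : ℕ) :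
    flagLaplacian * quantize (heatSymbol k) =
      (k + 1 : ℝ) • quantize (heatSymbol (k + 1 : ℕ)) := by
  rw [flagLaplacian, add_mul, add_mul, mul_assoc, mul_assoc, D_sq_mul_quantize, D_sq_mul_quantize,
    D_sq_mul_quantize, ← quantize_X_inl_mul, ← quantize_X_inl_mul, ← map_add, ← map_add,
    ← map_smul, ← Nat.cast_add_one, smul_heatSymbol, sum_univ_eleven]
  refine congrArg quantize ?_
  -- Both sides expand to the same combination of the symbols `heatSymbol (k + 1 - w)`, `w ≤ 7`.
  simp only [pderiv_x_heatSymbol, pderiv_y_heatSymbol, pderiv_z_heatSymbol, map_add,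
    map_zero, Derivation.map_smul, Derivation.leibniz, Derivation.leibniz_pow, smul_eq_mul,
    pderiv_X_of_ne Sum.inr_ne_inl]
  generalize heatSymbol = G
  simp only [tau, coeffPart, diffPart, wt, Matrix.cons_val, Nat.cast_ofNat, Nat.cast_one,
    Nat.cast_add, sub_sub, add_sub_assoc, sub_self, Int.reduceAdd, Int.reduceSub, map_one,
    map_mul, map_add, map_pow, map_smul, rename_X, smul_zero, mul_zero, add_zero]
  algebra

theorem flagLaplacian_pow (k : ℕ) : flagLaplacian ^ k = ∑ α ∈ level wt k, dOp α := by
  rw [← factorial_smul_quantize_heatSymbol]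
  induction k with
  | zero => simp [heatSymbol_zero, quantize_one]
  | succ k ih =>
    rw [pow_succ', ih, mul_smul_comm, flagLaplacian_mul_quantize_heatSymbol, smul_smul,
      ← Nat.cast_add_one, ← Nat.cast_mul, mul_comm, ← Nat.factorial_succ]

end FlagLaplacian

section Finiteness

theorem diffPart_mem_idealOfVars (j : Fin 11) : diffPart j ∈ idealOfVars (Fin 3) ℝ := by
  have hX : ∀ i, (X i : Poly3) ∈ idealOfVars (Fin 3) ℝ := fun i => Ideal.subset_span ⟨i, rfl⟩
  have hpow : ∀ i n, n ≠ 0 → (X i ^ n : Poly3) ∈ idealOfVars (Fin 3) ℝ := fun i n hn =>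
    Ideal.pow_mem_of_mem _ (hX i) n (Nat.pos_of_ne_zero hn)
  have hsmul : ∀ (c : ℝ) {p : Poly3}, p ∈ idealOfVars (Fin 3) ℝ → c • p ∈ idealOfVars (Fin 3) ℝ :=
    fun c _ hp => Submodule.smul_of_tower_mem _ c hp
  fin_cases j <;>
    simp only [diffPart, Fin.reduceFinMk, Matrix.cons_val, Fin.isValue, Fin.zero_eta,
      Fin.mk_one] <;>
    repeat' first
      | exact hpow _ _ (by norm_num)
      | refine hsmul _ ?_
      | refine add_mem ?_ ?_
      | refine Ideal.mul_mem_left _ _ ?_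

theorem dOp_apply_eq_zero {f : Poly3} {α : Fin 11 → ℕ} (h : f.totalDegree < ∑ j, α j) :
    dOp α f = 0 := by
  have hmem : ∏ j, diffPart j ^ α j ∈ idealOfVars (Fin 3) ℝ ^ ∑ j, α j := by
    rw [← Finset.prod_pow_eq_pow_sum]
    exact Ideal.prod_mem_prod fun j _ => Ideal.pow_mem_pow (diffPart_mem_idealOfVars j) _
  have hzero : diffOp (∏ j, diffPart j ^ α j) f = 0 := diffOp_eq_zero hmem fun m hm =>
    coeff_eq_zero_of_totalDegree_lt (h.trans_le hm)
  rw [dOp_eq, LinearMap.smul_apply, Module.End.mul_apply, hzero, map_zero, smul_zero]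

theorem finite_dOp_apply_ne_zero (f : Poly3) : {α | dOp α f ≠ 0}.Finite := by
  refine (Fintype.piFinset fun _ => Finset.range (f.totalDegree + 1)).finite_toSet.subset
    fun α hα => Fintype.mem_piFinset.2 fun j => Finset.mem_range.2 (Nat.lt_succ_of_le ?_)
  by_contra! hlt
  exact hα (dOp_apply_eq_zero (hlt.trans_le (Finset.single_le_sum (f := α)
    (fun _ _ => Nat.zero_le _) (Finset.mem_univ j))))

theorem exists_dOp_apply_eq_zero_of_le_weight (f : Poly3) :
    ∃ N, ∀ α, N ≤ weight α → dOp α f = 0 := by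
  obtain ⟨N, hN⟩ := ((finite_dOp_apply_ne_zero f).image weight).bddAbove
  refine ⟨N + 1, fun α hα => ?_⟩
  by_contra hne
  exact (Nat.lt_of_succ_le hα).not_ge (hN ⟨α, hne, rfl⟩)

theorem flagLaplacian_pow_apply_eq_zero {f : Poly3} {N : ℕ}
    (hN : ∀ α, N ≤ weight α → dOp α f = 0) : (flagLaplacian ^ N) f = 0 := by
  rw [flagLaplacian_pow, LinearMap.sum_apply]
  exact Finset.sum_eq_zero fun α hα => hN α (mem_level_wt.1 hα).ge

theorem finsum_mul_eval_dOp {f : Poly3} {N : ℕ} (hN : ∀ α, N ≤ weight α → dOp α f = 0)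
    (c : ℕ → ℝ) (v : Fin 3 → ℝ) :
    ∑ᶠ α, c (weight α) * eval v (dOp α f) =
      ∑ k ∈ Finset.range N, c k * eval v ((flagLaplacian ^ k) f) := by
  have hsupp : (Function.support fun α => c (weight α) * eval v (dOp α f)) ⊆
      (Finset.range N).biUnion fun k => level wt k := fun α hα => by
    refine Finset.mem_biUnion.2 ⟨weight α, Finset.mem_range.2 ?_, mem_level_wt.2 rfl⟩
    by_contra! hle
    exact hα (by simp only [hN α hle, map_zero, mul_zero])
  have hdisj : (Finset.range N : Set ℕ).PairwiseDisjoint fun k => level wt k :=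
    fun k _ l _ hkl => Finset.disjoint_left.2 fun α hk hl =>
      hkl ((mem_level_wt.1 hk).symm.trans (mem_level_wt.1 hl))
  rw [finsum_eq_sum_of_support_subset _ hsupp, Finset.sum_biUnion hdisj]
  refine Finset.sum_congr rfl fun k _ => ?_
  rw [flagLaplacian_pow, LinearMap.sum_apply, map_sum, Finset.mul_sum]
  exact Finset.sum_congr rfl fun α hα => by rw [mem_level_wt.1 hα]

end Finiteness

section XiPolynomials

variable {K : Type*} [Field K]

/-- The coefficient of `t ^ j` in `ξ_{b,r+j}`. The factor `j` makes the constant terms vanish for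
`r ≥ 1`. -/
noncomputable def xiCoeff (b : K) : ℕ → ℕ → K
  | 0, j => 1 / (j ! * b ^ j)
  | r + 1, j => (-1) ^ (r + 1) * j * (2 * r + 1 + j)! /
      ((r + 1 + j)! * j ! * (r + 1)! * b ^ (2 * r + 2 + j))

/-- `ξ_{b,i}` as a polynomial. -/
noncomputable def xiPoly (b : K) (i : ℕ) : Polynomial K :=
  ∑ p ∈ Finset.HasAntidiagonal.antidiagonal i, Polynomial.monomial p.2 (xiCoeff b p.1 p.2)

theorem xiPoly_zero (b : K) : xiPoly b 0 = 1 := by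
  simp [xiPoly, xiCoeff]

theorem coeff_xiPoly_add (b : K) (r j : ℕ) : (xiPoly b (r + j)).coeff j = xiCoeff b r j := by
  rw [xiPoly, Polynomial.finsetSum_coeff,
    Finset.sum_eq_single_of_mem (r, j) (Finset.HasAntidiagonal.mem_antidiagonal.2 rfl),
    Polynomial.coeff_monomial_same]
  rintro ⟨r', j'⟩ hmem hne
  refine Polynomial.coeff_monomial_of_ne _ fun h => hne ?_
  rw [Finset.HasAntidiagonal.mem_antidiagonal] at hmem
  grind

theorem coeff_xiPoly_of_lt (b : K) {i j : ℕ} (h : i < j) : (xiPoly b i).coeff j = 0 := by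
  rw [xiPoly, Polynomial.finsetSum_coeff]
  refine Finset.sum_eq_zero fun p hp => Polynomial.coeff_monomial_of_ne _ ?_
  have := Finset.HasAntidiagonal.mem_antidiagonal.1 hp
  omega

variable [CharZero K] {b : K}

theorem mul_xiCoeff_zero_succ (hb : b ≠ 0) (j : ℕ) :
    b * ((j + 1) * xiCoeff b 0 (j + 1)) = xiCoeff b 0 j := by
  have hj : (j ! : K) ≠ 0 := Nat.cast_ne_zero.2 j.factorial_ne_zero
  have hj₁ : (j + 1 : K) ≠ 0 := Nat.cast_add_one_ne_zero j
  simp only [xiCoeff, Nat.factorial_succ]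
  push_cast
  field_simp
  ring

theorem xiCoeff_succ_succ (hb : b ≠ 0) (r j : ℕ) :
    (j + 1) * (j + 2) * xiCoeff b r (j + 2) + b * ((j + 1) * xiCoeff b (r + 1) (j + 1)) =
      xiCoeff b (r + 1) j := by
  have hj : (j ! : K) ≠ 0 := Nat.cast_ne_zero.2 j.factorial_ne_zero
  have hj₁ : (j + 1 : K) ≠ 0 := Nat.cast_add_one_ne_zero j
  have hj₂ : (j + 1 + 1 : K) ≠ 0 := by exact_mod_cast (j + 1).succ_ne_zero
  obtain _ | r := r
  · simp only [xiCoeff, zero_add, mul_zero, show 1 + (j + 1) = j + 1 + 1 by ring,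
      show 1 + j = j + 1 by ring, Nat.factorial_succ (j + 1), Nat.factorial_succ j,
      Nat.factorial_one]
    push_cast
    field_simp
    ring
  · have hF : ((r + j + 2)! : K) ≠ 0 := Nat.cast_ne_zero.2 (Nat.factorial_ne_zero _)
    have hr : (r ! : K) ≠ 0 := Nat.cast_ne_zero.2 r.factorial_ne_zero
    have hr₁ : (r + 1 : K) ≠ 0 := Nat.cast_add_one_ne_zero r
    have hr₂ : (r + 1 + 1 : K) ≠ 0 := by exact_mod_cast (r + 1).succ_ne_zero
    have hrj : (r + j + 2 + 1 : K) ≠ 0 := by exact_mod_cast (r + j + 2).succ_ne_zero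
    simp only [xiCoeff, show r + 1 + (j + 2) = r + j + 2 + 1 by ring,
      show r + 1 + 1 + (j + 1) = r + j + 2 + 1 by ring, show r + 1 + 1 + j = r + j + 2 by ring,
      show 2 * r + 1 + (j + 2) = 2 * r + j + 3 by ring,
      show 2 * (r + 1) + 1 + (j + 1) = 2 * r + j + 3 + 1 by ring,
      show 2 * (r + 1) + 1 + j = 2 * r + j + 3 by ring, Nat.factorial_succ (r + j + 2),
      Nat.factorial_succ (2 * r + j + 3), Nat.factorial_succ r, Nat.factorial_succ (r + 1),
      Nat.factorial_succ j, Nat.factorial_succ (j + 1)]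
    generalize (2 * r + j + 3)! = G, (r + j + 2)! = F at hF ⊢
    push_cast
    field_simp
    ring

theorem derivative_derivative_xiPoly_add (hb : b ≠ 0) (i : ℕ) :
    (xiPoly b (i + 1)).derivative.derivative + Polynomial.C b * (xiPoly b (i + 1)).derivative =
      xiPoly b i := by
  ext j
  simp only [Polynomial.coeff_add, Polynomial.coeff_C_mul, Polynomial.coeff_derivative]
  rcases lt_trichotomy i j with hij | rfl | hji
  · simp only [coeff_xiPoly_of_lt b hij, coeff_xiPoly_of_lt b (show i + 1 < j + 1 by omega),
      coeff_xiPoly_of_lt b (show i + 1 < j + 1 + 1 by omega), zero_mul, mul_zero, add_zero]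
  · have hi : (xiPoly b i).coeff i = xiCoeff b 0 i := by simpa using coeff_xiPoly_add b 0 i
    have hi₁ : (xiPoly b (i + 1)).coeff (i + 1) = xiCoeff b 0 (i + 1) := by
      simpa using coeff_xiPoly_add b 0 (i + 1)
    rw [coeff_xiPoly_of_lt b (Nat.lt_succ_self (i + 1)), hi, hi₁,
      ← mul_xiCoeff_zero_succ hb i]
    ring
  · obtain ⟨r, rfl⟩ := Nat.exists_eq_add_of_lt hji
    have h₀ : (xiPoly b (j + r + 1)).coeff j = xiCoeff b (r + 1) j := by
      rw [show j + r + 1 = r + 1 + j by ring, coeff_xiPoly_add]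
    have h₁ : (xiPoly b (j + r + 1 + 1)).coeff (j + 1) = xiCoeff b (r + 1) (j + 1) := by
      rw [show j + r + 1 + 1 = r + 1 + (j + 1) by ring, coeff_xiPoly_add]
    have h₂ : (xiPoly b (j + r + 1 + 1)).coeff (j + 1 + 1) = xiCoeff b r (j + 2) := by
      rw [show j + r + 1 + 1 = r + (j + 1 + 1) by ring, coeff_xiPoly_add]
    rw [h₀, h₁, h₂, ← xiCoeff_succ_succ hb r j]
    push_cast
    ring

theorem factorial_mul_prod_Icc {R : Type*} [CommSemiring R] (n r : ℕ) :
    n ! * ∏ s ∈ Finset.Icc 1 r, ((n : R) + s) = (n + r)! := by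
  induction r with
  | zero => simp
  | succ r ih =>
    rw [Finset.prod_Icc_succ_top (Nat.le_add_left 1 r), ← mul_assoc, ih, ← add_assoc n r 1,
      Nat.factorial_succ]
    push_cast
    ring

theorem xiCoeff_succ_eq_prod (b : K) (r j : ℕ) :
    xiCoeff b (r + 1) (j + 1) =
      (-1) ^ (r + 1) * (∏ s ∈ Finset.Icc 1 r, (((j + (r + 1) + 1 : ℕ) : K) + s)) /
        (j ! * (r + 1)! * b ^ (r + 1 + (j + (r + 1) + 1))) := by
  have hj : (j + 1 : K) ≠ 0 := Nat.cast_add_one_ne_zero j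
  have hF : ((j + (r + 1) + 1)! : K) ≠ 0 := Nat.cast_ne_zero.2 (Nat.factorial_ne_zero _)
  rw [xiCoeff, show 2 * r + 1 + (j + 1) = j + (r + 1) + 1 + r by ring, ← factorial_mul_prod_Icc,
    show r + 1 + (j + 1) = j + (r + 1) + 1 by ring,
    show r + 1 + (j + (r + 1) + 1) = 2 * r + 2 + (j + 1) by ring, Nat.factorial_succ j]
  generalize ∏ s ∈ Finset.Icc 1 r, (((j + (r + 1) + 1 : ℕ) : K) + (s : K)) = p,
    (j + (r + 1) + 1)! = F at hF ⊢
  push_cast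
  field_simp

end XiPolynomials

theorem xi_eq_eval (b : ℂ) (i : ℕ) (t : ℂ) : xi b i t = (xiPoly b i).eval t := by
  obtain _ | n := i
  · simp [xi, xiPoly_zero]
  have hlead : t ^ (n + 1) / ((n + 1)! * b ^ (n + 1)) =
      (Polynomial.monomial (n + 1 - 0) (xiCoeff b 0 (n + 1 - 0))).eval t := by
    rw [Polynomial.eval_monomial, xiCoeff, Nat.sub_zero]
    ring
  have hlast : (Polynomial.monomial (n + 1 - (n + 1)) (xiCoeff b (n + 1) (n + 1 - (n + 1)))).eval t
      = 0 := by
    simp [xiCoeff]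
  rw [xi, xiPoly, Finset.Nat.sum_antidiagonal_eq_sum_range_succ
    (fun r j => Polynomial.monomial j (xiCoeff b r j)), Finset.sum_range_succ,
    Finset.sum_range_succ', Polynomial.eval_add, Polynomial.eval_add, Polynomial.eval_finsetSum,
    hlead, hlast, add_zero, add_comm, Finset.range_eq_Ico, Finset.sum_Ico_add'
    (fun r => (Polynomial.monomial (n + 1 - r) (xiCoeff b r (n + 1 - r))).eval t) 0 n 1, zero_add,
    Finset.Ico_add_one_right_eq_Icc, Nat.add_sub_cancel]
  refine congrArg (· + _) (Finset.sum_congr rfl fun r hr => ?_)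
  obtain ⟨hr₁, hrn⟩ := Finset.mem_Icc.1 hr
  obtain ⟨r, rfl⟩ := Nat.exists_eq_add_of_le' hr₁
  obtain ⟨j, rfl⟩ := Nat.exists_eq_add_of_le' hrn
  rw [Nat.add_sub_cancel, show j + (r + 1) + 1 - (r + 1) - 1 = j by omega,
    show j + (r + 1) + 1 - (r + 1) = j + 1 by omega, Polynomial.eval_monomial,
    xiCoeff_succ_eq_prod]

section Solutions

variable {𝕜 : Type*} [NontriviallyNormedField 𝕜]

theorem iteratedDeriv_two_eq {E : Type*} [NormedAddCommGroup E] [NormedSpace 𝕜 E] {f g h : 𝕜 → E}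
    (hf : ∀ s, HasDerivAt f (g s) s) (hg : ∀ s, HasDerivAt g (h s) s) :
    iteratedDeriv 2 f = h := by
  rw [iteratedDeriv_succ, iteratedDeriv_one, funext fun s => (hf s).deriv,
    funext fun s => (hg s).deriv]

theorem hasDerivAt_eval_update {σ : Type*} [DecidableEq σ] (p : MvPolynomial σ 𝕜) (j : σ)
    (v : σ → 𝕜) (s : 𝕜) :
    HasDerivAt (fun s => eval (Function.update v j s) p)
      (eval (Function.update v j s) (pderiv j p)) s := by
  induction p using MvPolynomial.induction_on with
  | C c => simpa using hasDerivAt_const s c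
  | add p q hp hq => simpa using hp.fun_add hq
  | mul_X p i hp =>
    have hX : HasDerivAt (fun s => Function.update v j s i) (if i = j then 1 else 0) s := by
      obtain rfl | hij := eq_or_ne i j
      · simpa using hasDerivAt_id' s
      · simpa [hij] using hasDerivAt_const s (v i)
    simp only [map_mul, eval_X, pderiv_mul, map_add, pderiv_X]
    refine (hp.mul hX).congr_deriv ?_
    obtain rfl | hij := eq_or_ne i j
    · simp
    · simp [hij]

theorem contDiff_eval {σ E : Type*} [NormedAddCommGroup E] [NormedSpace 𝕜 E] {n : WithTop ℕ∞}
    (p : MvPolynomial σ 𝕜) {v : E → σ → 𝕜} (hv : ∀ i, ContDiff 𝕜 n fun e => v e i) :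
    ContDiff 𝕜 n fun e => eval (v e) p := by
  induction p using MvPolynomial.induction_on with
  | C c => simpa using contDiff_const
  | add p q hp hq => simpa using hp.add hq
  | mul_X p i hp => simpa using hp.mul (hv i)

theorem eval_flagLaplacian (p : Poly3) (x y z : ℝ) :
    eval ![x, y, z] (flagLaplacian p) =
      iteratedDeriv 2 (fun s => eval ![s, y, z] p) x +
        x * iteratedDeriv 2 (fun s => eval ![x, s, z] p) y +
        y * iteratedDeriv 2 (fun s => eval ![x, y, s] p) z := by
  have h : ∀ j, iteratedDeriv 2 (fun s => eval (Function.update ![x, y, z] j s) p) =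
      fun s => eval (Function.update ![x, y, z] j s) (pderiv j (pderiv j p)) := fun j =>
    iteratedDeriv_two_eq (hasDerivAt_eval_update p j _)
      (hasDerivAt_eval_update (pderiv j p) j _)
  have hx : ∀ s, Function.update ![x, y, z] 0 s = ![s, y, z] := fun s => by
    ext i; fin_cases i <;> rfl
  have hy : ∀ s, Function.update ![x, y, z] 1 s = ![x, s, z] := fun s => by
    ext i; fin_cases i <;> rfl
  have hz : ∀ s, Function.update ![x, y, z] 2 s = ![x, y, s] := fun s => by
    ext i; fin_cases i <;> rfl
  have h₀ := h 0
  have h₁ := h 1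
  have h₂ := h 2
  simp only [hx, hy, hz] at h₀ h₁ h₂
  rw [h₀, h₁, h₂]
  simp [flagLaplacian, D, pow_two]

theorem contDiff_sum_mul_eval {n : WithTop ℕ∞} {c : ℕ → ℝ → ℝ} (hc : ∀ k, ContDiff ℝ n (c k))
    (g : ℕ → Poly3) (N : ℕ) :
    ContDiff ℝ n fun p : ℝ × ℝ × ℝ × ℝ =>
      ∑ k ∈ Finset.range N, c k p.1 * eval ![p.2.1, p.2.2.1, p.2.2.2] (g k) := by
  refine ContDiff.sum fun k _ => ((hc k).comp contDiff_fst).mul (contDiff_eval _ fun i => ?_)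
  fin_cases i
  · exact contDiff_fst.comp contDiff_snd
  · exact contDiff_fst.comp (contDiff_snd.comp contDiff_snd)
  · exact contDiff_snd.comp (contDiff_snd.comp contDiff_snd)

theorem iteratedDeriv_two_sum_add {a : ℝ} {c : ℕ → ℝ → ℝ} (hc : ∀ k, ContDiff ℝ 2 (c k))
    (hzero : ∀ t, iteratedDeriv 2 (c 0) t + a ^ 2 * c 0 t = 0)
    (hsucc : ∀ k t, iteratedDeriv 2 (c (k + 1)) t + a ^ 2 * c (k + 1) t = c k t)
    {e : ℕ → ℝ} {N : ℕ} (he : e N = 0) (t : ℝ) :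
    iteratedDeriv 2 (fun s => ∑ k ∈ Finset.range N, c k s * e k) t +
        a ^ 2 * ∑ k ∈ Finset.range N, c k t * e k =
      ∑ k ∈ Finset.range N, c k t * e (k + 1) := by
  have hderiv : iteratedDeriv 2 (fun s => ∑ k ∈ Finset.range N, c k s * e k) t =
      ∑ k ∈ Finset.range N, iteratedDeriv 2 (c k) t * e k := by
    rw [iteratedDeriv_fun_sum fun k _ => ((hc k).mul contDiff_const).contDiffAt]
    simp only [iteratedDeriv_mul_const_field]
  rw [hderiv, Finset.mul_sum, ← Finset.sum_add_distrib]
  simp only [← mul_assoc, ← add_mul]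
  obtain _ | M := N
  · rfl
  · rw [Finset.sum_range_succ', Finset.sum_range_succ, hzero, he]
    simp only [hsucc, zero_mul, mul_zero]

theorem isSolution_sum {a : ℝ} {c : ℕ → ℝ → ℝ} (hc : ∀ k, ContDiff ℝ ∞ (c k))
    (hzero : ∀ t, iteratedDeriv 2 (c 0) t + a ^ 2 * c 0 t = 0)
    (hsucc : ∀ k t, iteratedDeriv 2 (c (k + 1)) t + a ^ 2 * c (k + 1) t = c k t)
    {f : Poly3} {N : ℕ} (hN : (flagLaplacian ^ N) f = 0) :
    IsSolution a fun t x y z =>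
      ∑ k ∈ Finset.range N, c k t * eval ![x, y, z] ((flagLaplacian ^ k) f) := by
  refine ⟨contDiff_sum_mul_eval hc _ N, fun t x y z => ?_⟩
  have hlast : eval ![x, y, z] ((flagLaplacian ^ N) f) = 0 := by rw [hN, map_zero]
  have htime := iteratedDeriv_two_sum_add (fun k => contDiff_infty.1 (hc k) 2) hzero hsucc
    (e := fun k => eval ![x, y, z] ((flagLaplacian ^ k) f)) hlast t
  have heval : ∀ x y z, eval ![x, y, z] (∑ k ∈ Finset.range N, c k t • (flagLaplacian ^ k) f) =
      ∑ k ∈ Finset.range N, c k t * eval ![x, y, z] ((flagLaplacian ^ k) f) := fun x y z => by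
    simp only [map_sum, smul_eval]
  have hspace := eval_flagLaplacian (∑ k ∈ Finset.range N, c k t • (flagLaplacian ^ k) f) x y z
  simp only [heval] at hspace
  have hshift : eval ![x, y, z] (flagLaplacian (∑ k ∈ Finset.range N,
      c k t • (flagLaplacian ^ k) f)) =
        ∑ k ∈ Finset.range N, c k t * eval ![x, y, z] ((flagLaplacian ^ (k + 1)) f) := by
    simp only [map_sum, map_smul, smul_eval, pow_succ', Module.End.mul_apply]
  linarith

/-- The function `e^{iat} ξ_{2ai,k}(t)`, whose real and imaginary parts are the coefficients of the
two solutions. -/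
noncomputable def timeFactor (a : ℝ) (k : ℕ) (t : ℝ) : ℂ :=
  Complex.exp (a * Complex.I * t) * xi (2 * a * Complex.I) k t

theorem hasDerivAt_exp_mul_eval (β : ℂ) (p : Polynomial ℂ) (t : ℝ) :
    HasDerivAt (fun s : ℝ => Complex.exp (β * s) * p.eval (s : ℂ))
      (Complex.exp (β * t) * (p.derivative + Polynomial.C β * p).eval (t : ℂ)) t := by
  have hexp : HasDerivAt (fun z : ℂ => Complex.exp (β * z)) (Complex.exp (β * t) * β) t := by
    simpa using ((hasDerivAt_id (t : ℂ)).const_mul β).cexp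
  refine (hexp.mul (p.hasDerivAt t)).comp_ofReal.congr_deriv ?_
  simp only [Polynomial.eval_add, Polynomial.eval_mul, Polynomial.eval_C]
  ring

theorem contDiff_timeFactor (a : ℝ) (k : ℕ) : ContDiff ℝ ∞ (timeFactor a k) := by
  have hpoly : ContDiff ℂ ∞ fun z : ℂ => (xiPoly (2 * a * Complex.I) k).eval z := by
    simpa only [Polynomial.coe_aeval_eq_eval] using
      (xiPoly (2 * a * Complex.I) k).contDiff_aeval (𝕜 := ℂ) ∞
  have h : ContDiff ℂ ∞ fun z : ℂ =>
      Complex.exp (a * Complex.I * z) * (xiPoly (2 * a * Complex.I) k).eval z :=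
    (contDiff_const.mul contDiff_id).cexp.mul hpoly
  have heq : timeFactor a k = (fun z : ℂ => Complex.exp (a * Complex.I * z) *
      (xiPoly (2 * a * Complex.I) k).eval z) ∘ Complex.ofRealCLM :=
    funext fun t => by simp only [timeFactor, xi_eq_eval, Function.comp, Complex.ofRealCLM_apply]
  exact heq ▸ (h.restrict_scalars ℝ).comp Complex.ofRealCLM.contDiff

theorem iteratedDeriv_two_timeFactor_add (ℓ : ℂ →L[ℝ] ℝ) (a : ℝ) (k : ℕ) (t : ℝ) :
    iteratedDeriv 2 (fun s => ℓ (timeFactor a k s)) t + a ^ 2 * ℓ (timeFactor a k t) =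
      ℓ (Complex.exp (a * Complex.I * t) *
        ((xiPoly (2 * a * Complex.I) k).derivative.derivative +
          Polynomial.C (2 * a * Complex.I) *
            (xiPoly (2 * a * Complex.I) k).derivative).eval (t : ℂ)) := by
  set β : ℂ := a * Complex.I
  have hderiv : ∀ (p : Polynomial ℂ) (s : ℝ), HasDerivAt
      (fun s : ℝ => ℓ (Complex.exp (β * s) * p.eval (s : ℂ)))
      (ℓ (Complex.exp (β * s) * (p.derivative + Polynomial.C β * p).eval (s : ℂ))) s :=
    fun p s => ℓ.hasFDerivAt.comp_hasDerivAt s (hasDerivAt_exp_mul_eval β p s)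
  simp only [timeFactor, xi_eq_eval]
  rw [iteratedDeriv_two_eq (hderiv _) (hderiv _), ← smul_eq_mul (a ^ 2), ← map_smul, ← map_add]
  refine congrArg ℓ ?_
  simp only [Polynomial.derivative_add, Polynomial.derivative_C_mul, Polynomial.eval_add,
    Polynomial.eval_mul, Polynomial.eval_C, Complex.real_smul, Complex.ofReal_pow]
  have hβ : β ^ 2 = -(a : ℂ) ^ 2 := by rw [mul_pow, Complex.I_sq, mul_neg_one]
  linear_combination (Complex.exp (β * t) * (xiPoly (2 * a * Complex.I) k).eval (t : ℂ)) * hβ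

theorem isSolution_sum_timeFactor (ℓ : ℂ →L[ℝ] ℝ) {a : ℝ} (ha : a ≠ 0) {f : Poly3} {N : ℕ}
    (hN : (flagLaplacian ^ N) f = 0) :
    IsSolution a fun t x y z => ∑ k ∈ Finset.range N,
      ℓ (timeFactor a k t) * eval ![x, y, z] ((flagLaplacian ^ k) f) := by
  have hb : 2 * (a : ℂ) * Complex.I ≠ 0 := by simp [ha]
  refine isSolution_sum (c := fun k t => ℓ (timeFactor a k t))
    (fun k => ℓ.contDiff.comp (contDiff_timeFactor a k)) (fun t => ?_) (fun k t => ?_) hN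
  · rw [iteratedDeriv_two_timeFactor_add, xiPoly_zero]
    simp
  · rw [iteratedDeriv_two_timeFactor_add, derivative_derivative_xiPoly_add hb, timeFactor,
      xi_eq_eval]

theorem re_timeFactor (a : ℝ) (k : ℕ) (t : ℝ) : (timeFactor a k t).re =
    Real.cos (a * t) * zeta0 a k t - Real.sin (a * t) * zeta1 a k t := by
  rw [timeFactor, mul_right_comm (a : ℂ), ← Complex.ofReal_mul, Complex.mul_re,
    Complex.exp_ofReal_mul_I_re, Complex.exp_ofReal_mul_I_im, zeta0, zeta1]

theorem im_timeFactor (a : ℝ) (k : ℕ) (t : ℝ) : (timeFactor a k t).im =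
    Real.sin (a * t) * zeta0 a k t + Real.cos (a * t) * zeta1 a k t := by
  rw [timeFactor, mul_right_comm (a : ℂ), ← Complex.ofReal_mul, Complex.mul_im,
    Complex.exp_ofReal_mul_I_re, Complex.exp_ofReal_mul_I_im, zeta0, zeta1, add_comm]

end Solutions

section Polynomiality

theorem exists_polynomial_eval_eq (ℓ : ℂ →ₗ[ℝ] ℝ) (p : Polynomial ℂ) :
    ∃ q : Polynomial ℝ, ∀ t : ℝ, q.eval t = ℓ (p.eval (t : ℂ)) := by
  induction p using Polynomial.induction_on' with
  | add p₁ p₂ h₁ h₂ =>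
    obtain ⟨q₁, hq₁⟩ := h₁
    obtain ⟨q₂, hq₂⟩ := h₂
    exact ⟨q₁ + q₂, fun t => by simp only [Polynomial.eval_add, hq₁, hq₂, map_add]⟩
  | monomial n c =>
    refine ⟨Polynomial.monomial n (ℓ c), fun t => ?_⟩
    rw [Polynomial.eval_monomial, Polynomial.eval_monomial, ← Complex.ofReal_pow, mul_comm c,
      ← Complex.real_smul, map_smul, smul_eq_mul, mul_comm]

theorem exists_eval_vecCons_eq_sum {R κ : Type*} [CommSemiring R] {n : ℕ} (s : Finset κ)
    (q : κ → Polynomial R) (g : κ → MvPolynomial (Fin n) R) :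
    ∃ p : MvPolynomial (Fin (n + 1)) R,
      ∀ t v, ∑ k ∈ s, (q k).eval t * eval v (g k) = eval (Matrix.vecCons t v) p := by
  refine ⟨∑ k ∈ s, Polynomial.aeval (X 0) (q k) * rename Fin.succ (g k), fun t v => ?_⟩
  rw [map_sum]
  refine Finset.sum_congr rfl fun k _ => ?_
  have hq : eval (Matrix.vecCons t v) (Polynomial.aeval (X 0) (q k)) = (q k).eval t := by
    rw [← coe_aeval_eq_eval, RingHom.coe_coe, ← Polynomial.aeval_algHom_apply, aeval_X,
      Matrix.cons_val_zero, Polynomial.coe_aeval_eq_eval]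
  rw [map_mul, eval_rename, hq]
  rfl

theorem exists_eval_eq_sum_xi (ℓ : ℂ →ₗ[ℝ] ℝ) (b : ℂ) (s : Finset ℕ) (g : ℕ → Poly3) :
    ∃ p : MvPolynomial (Fin 4) ℝ, ∀ t x y z : ℝ,
      ∑ k ∈ s, ℓ (xi b k t) * eval ![x, y, z] (g k) = eval ![t, x, y, z] p := by
  choose q hq using fun k => exists_polynomial_eval_eq ℓ (xiPoly b k)
  obtain ⟨p, hp⟩ := exists_eval_vecCons_eq_sum s q g
  refine ⟨p, fun t x y z => ?_⟩
  rw [← hp]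
  simp only [hq, xi_eq_eval]

end Polynomiality

end KleinGordon

theorem theorem2p6 (a : ℝ) (ha : a ≠ 0) (m₁ m₂ m₃ : ℕ) :
    {α : Fin 11 → ℕ | KleinGordon.dMon m₁ m₂ m₃ α ≠ 0}.Finite ∧
    (∃ p q : MvPolynomial (Fin 4) ℝ, ∀ t x y z : ℝ,
      KleinGordon.P a m₁ m₂ m₃ t x y z = MvPolynomial.eval ![t, x, y, z] p ∧
      KleinGordon.Q a m₁ m₂ m₃ t x y z = MvPolynomial.eval ![t, x, y, z] q) ∧
    KleinGordon.IsSolution a (fun t x y z =>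
      Real.cos (a * t) * KleinGordon.P a m₁ m₂ m₃ t x y z -
        Real.sin (a * t) * KleinGordon.Q a m₁ m₂ m₃ t x y z) ∧
    KleinGordon.IsSolution a (fun t x y z =>
      Real.sin (a * t) * KleinGordon.P a m₁ m₂ m₃ t x y z +
        Real.cos (a * t) * KleinGordon.Q a m₁ m₂ m₃ t x y z) := by
  open KleinGordon in
  set f : Poly3 := X 0 ^ m₁ * X 1 ^ m₂ * X 2 ^ m₃
  obtain ⟨N, hN⟩ := exists_dOp_apply_eq_zero_of_le_weight f
  have hP : ∀ t x y z, P a m₁ m₂ m₃ t x y z =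
      ∑ k ∈ Finset.range N, zeta0 a k t * eval ![x, y, z] ((flagLaplacian ^ k) f) :=
    fun t x y z => finsum_mul_eval_dOp hN (fun k => zeta0 a k t) _
  have hQ : ∀ t x y z, Q a m₁ m₂ m₃ t x y z =
      ∑ k ∈ Finset.range N, zeta1 a k t * eval ![x, y, z] ((flagLaplacian ^ k) f) :=
    fun t x y z => finsum_mul_eval_dOp hN (fun k => zeta1 a k t) _
  have hf : (flagLaplacian ^ N) f = 0 := flagLaplacian_pow_apply_eq_zero hN
  refine ⟨finite_dOp_apply_ne_zero f, ?_, ?_, ?_⟩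
  · obtain ⟨p, hp⟩ := exists_eval_eq_sum_xi Complex.reLm (2 * a * Complex.I) (Finset.range N)
      fun k => (flagLaplacian ^ k) f
    obtain ⟨q, hq⟩ := exists_eval_eq_sum_xi Complex.imLm (2 * a * Complex.I) (Finset.range N)
      fun k => (flagLaplacian ^ k) f
    exact ⟨p, q, fun t x y z => ⟨(hP t x y z).trans (hp t x y z), (hQ t x y z).trans (hq t x y z)⟩⟩
  · convert isSolution_sum_timeFactor Complex.reCLM ha hf using 5 with t x y z
    simp only [hP, hQ, Complex.reCLM_apply, re_timeFactor, Finset.mul_sum,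
      ← Finset.sum_sub_distrib, sub_mul, mul_assoc]
  · convert isSolution_sum_timeFactor Complex.imCLM ha hf using 5 with t x y z
    simp only [hP, hQ, Complex.imCLM_apply, im_timeFactor, Finset.mul_sum,
      ← Finset.sum_add_distrib, add_mul, mul_assoc]
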